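/- Let $(b_n)_{n\ge 1}$ be the sequence of real numbers defined by $b_1=\frac12$ and $$b_n=\frac1n\left(\frac1{n+1}-\sum_{k=0}^{n-2}\frac{b_{n-k-1}}{k+2}\right)\qquad(n\ge 2),$$ and for $s\in[0,1]$ let $g(s)=\frac1\pi\, s^s(1-s)^{1-s}\sin(\pi s)$, with the convention $0^0=1$. Then: (i) for every $n\ge 2$, $$b_n=\frac1e\int_0^1 g(s)(1-s)^{n-2}\,ds=\frac1e\int_0^1 g(s)s^{n-2}\,ds;$$ (ii) $0<b_n\le\frac1{n(n+1)}$ for every $n\ge 1$; (iii) $b_{n+1}<b_n$ for every $n\ge 1$; (iv) $\displaystyle\lim_{n\to\infty}\frac{b_{n+1}}{b_n}=1$. -/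

import Mathlib

/-- The sequence `b` of the paper, indexed from `1`; the value at index `0` is a dummy.
See `carlemanB_one` and `carlemanB_rec` for its recurrence in the usual form. -/
noncomputable def carlemanB : ℕ → ℝ
  | 0 => 0
  | 1 => 1 / 2
  | m + 2 => 1 / ((m : ℝ) + 2) *
      (1 / ((m : ℝ) + 3) - ∑ k : Fin (m + 1), carlemanB (m + 1 - k) / ((k : ℕ) + 2 : ℝ))
  termination_by n => n
  decreasing_by omega

/-- The initial value `b 1 = 1 / 2`. -/
theorem carlemanB_one : carlemanB 1 = 1 / 2 := by
  rw [carlemanB]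

/-- The recurrence: for `n ≥ 2`, with `k` running over `0, …, n - 2`. -/
theorem carlemanB_rec (n : ℕ) (hn : 2 ≤ n) :
    carlemanB n = 1 / (n : ℝ) *
      (1 / ((n : ℝ) + 1) -
        ∑ k ∈ Finset.range (n - 1), carlemanB (n - k - 1) / ((k : ℝ) + 2)) := by
  obtain ⟨m, rfl⟩ := Nat.exists_eq_add_of_le' hn
  rw [carlemanB, Fin.sum_univ_eq_sum_range
    (fun k => carlemanB (m + 1 - k) / ((k : ℝ) + 2)) (m + 1)]
  have h1 : m + 2 - 1 = m + 1 := rfl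
  have h2 : ∀ k, m + 2 - k - 1 = m + 1 - k := fun k => by omega
  simp only [h1, h2]
  push_cast
  ring

/-- The weight `g(s) = (1 / π) s ^ s (1 - s) ^ (1 - s) sin (π s)`. -/
noncomputable def carlemanG (s : ℝ) : ℝ :=
  1 / Real.pi * s ^ s * (1 - s) ^ (1 - s) * Real.sin (Real.pi * s)

open Filter Topology

/-! The recurrence says that `f(t) = 1 - ∑ bₙ tⁿ` solves `f' = p' f` with `p(t) = -∑ tⁿ / (n (n +
1))`. Hence `f(t) = exp ((1 - 1/t) log (1 - t) - 1)` (`tsum_carlemanCoeff_mul_pow`). Putting `t =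
1/z`, the function `P(z) = z (1 - 1/z) ^ (1 - z)` equals `e (z - b₁ - b₂/z - ⋯)` near infinity. It
is holomorphic in the upper half-plane and continuous up to the real axis, where its imaginary part
is `π g` on `[0, 1]` and zero elsewhere. Cauchy's theorem applied to `z ^ m P(z)` minus its leading
terms at infinity gives `e b_{m+2} = ∫ g(s) s ^ m` (`exp_one_mul_carlemanB_eq_integral`). Since `g >
0` on `(0, 1)`, positivity and monotonicity follow. Positivity fed back into the recurrence gives
the upper bound, the symmetry of `g` gives the other integral, and the ratio limit holds because
moments concentrate at `s = 1` (`tendsto_moment_ratio`). -/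

/-! ### Power series with bounded coefficients -/

theorem summable_norm_mul_pow_of_bounded {a : ℕ → ℂ} {M : ℝ} (ha : ∀ n, ‖a n‖ ≤ M) {z : ℂ}
    (hz : ‖z‖ < 1) : Summable fun n => ‖a n * z ^ n‖ := by
  refine Summable.of_nonneg_of_le (fun _ => norm_nonneg _) (fun n => ?_)
    ((summable_geometric_of_lt_one (norm_nonneg z) hz).mul_left M)
  rw [norm_mul, norm_pow]
  exact mul_le_mul_of_nonneg_right (ha n) (by positivity)

theorem hasDerivAt_tsum_mul_pow_of_bounded {a : ℕ → ℂ} {M : ℝ} (ha : ∀ n, ‖a n‖ ≤ M) {z : ℂ}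
    (hz : ‖z‖ < 1) :
    HasDerivAt (fun w => ∑' n, a n * w ^ n) (∑' n, a (n + 1) * (n + 1) * z ^ n) z := by
  obtain ⟨r, hzr, hr1⟩ := exists_between hz
  have hr0 : 0 ≤ r := (norm_nonneg z).trans hzr.le
  have hM : 0 ≤ M := (norm_nonneg _).trans (ha 0)
  have hu : Summable fun n : ℕ => M * (n * r ^ (n - 1)) := by
    refine Summable.mul_left M ((summable_nat_add_iff 1).mp ?_)
    have h1 := summable_pow_mul_geometric_of_norm_lt_one (R := ℝ) 1
      (show ‖r‖ < 1 by rwa [Real.norm_of_nonneg hr0])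
    have h0 := summable_geometric_of_lt_one hr0 hr1
    refine (h1.add h0).congr fun n => ?_
    simp
    ring
  have hbound : ∀ n : ℕ, ∀ y ∈ Metric.ball (0 : ℂ) r,
      ‖a n * (n * y ^ (n - 1))‖ ≤ M * (n * r ^ (n - 1)) := by
    intro n y hy
    rw [mem_ball_zero_iff] at hy
    rw [norm_mul, norm_mul, norm_pow, Complex.norm_natCast]
    have := pow_le_pow_left₀ (norm_nonneg y) hy.le (n - 1)
    have := ha n
    gcongr
  have hmem : z ∈ Metric.ball (0 : ℂ) r := by rwa [mem_ball_zero_iff]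
  have key := hasDerivAt_tsum_of_isPreconnected (g := fun n w => a n * w ^ n)
    (g' := fun n w => a n * (n * w ^ (n - 1))) hu Metric.isOpen_ball
    (convex_ball (0 : ℂ) r).isPreconnected
    (fun n y _ => (hasDerivAt_pow n y).const_mul (a n)) hbound hmem
    (summable_norm_mul_pow_of_bounded ha hz).of_norm hmem
  refine key.congr_deriv ?_
  have hs : Summable fun n : ℕ => a n * (n * z ^ (n - 1)) :=
    Summable.of_norm_bounded hu fun n => hbound n z hmem
  rw [hs.tsum_eq_zero_add]
  simp [mul_assoc]

/-! ### The generating function in closed form -/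

/-- The coefficients `1, -b₁, -b₂, …` of `(1 + 1 / x) ^ x / e` in powers of `1 / (1 + x)`. -/
noncomputable def carlemanCoeff (n : ℕ) : ℂ := if n = 0 then 1 else -(carlemanB n : ℂ)

/-- A crude bound, enough for convergence in the unit disc: the bracket in the recurrence has `n`
terms of modulus at most one. -/
theorem abs_carlemanB_le_one (n : ℕ) : |carlemanB n| ≤ 1 := by
  induction n using Nat.strong_induction_on with
  | _ n ih =>
    rcases lt_or_ge n 2 with h | h
    · interval_cases n
      · rw [carlemanB]; simp
      · rw [carlemanB_one]; norm_num [abs_of_pos]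
    · rw [carlemanB_rec n h, abs_mul, abs_of_nonneg (by positivity : (0 : ℝ) ≤ 1 / n)]
      have hn : (2 : ℝ) ≤ n := by exact_mod_cast h
      have hsum : |∑ k ∈ Finset.range (n - 1), carlemanB (n - k - 1) / ((k : ℝ) + 2)|
          ≤ (n - 1 : ℕ) := by
        refine (Finset.abs_sum_le_sum_abs _ _).trans ?_
        refine (Finset.sum_le_card_nsmul _ _ 1 fun k hk => ?_).trans (by simp)
        rw [abs_div, abs_of_nonneg (by positivity : (0 : ℝ) ≤ (k : ℝ) + 2)]
        refine div_le_one_of_le₀ ((ih _ (by omega)).trans ?_) (by positivity)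
        have : (0 : ℝ) ≤ k := by positivity
        linarith
      rw [Nat.cast_sub (by omega), Nat.cast_one] at hsum
      have h1 : |1 / ((n : ℝ) + 1)| ≤ 1 := by
        rw [abs_of_nonneg (by positivity)]
        exact div_le_one_of_le₀ (by linarith) (by linarith)
      have h2 := abs_sub (1 / ((n : ℝ) + 1))
        (∑ k ∈ Finset.range (n - 1), carlemanB (n - k - 1) / ((k : ℝ) + 2))
      rw [one_div_mul_eq_div]
      exact div_le_one_of_le₀ (by linarith) (by linarith)

theorem norm_carlemanCoeff_le_one (n : ℕ) : ‖carlemanCoeff n‖ ≤ 1 := by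
  rw [carlemanCoeff]
  split_ifs
  · simp
  · rw [norm_neg, Complex.norm_real]
    exact abs_carlemanB_le_one n

/-- This is `f' = p' f` read off coefficientwise; the constant coefficient `1` absorbs the free term
of the recurrence. -/
theorem carlemanCoeff_succ_mul (n : ℕ) :
    carlemanCoeff (n + 1) * (n + 1) =
      ∑ k ∈ Finset.range (n + 1), -(1 / ((k : ℂ) + 2)) * carlemanCoeff (n - k) := by
  rcases Nat.eq_zero_or_pos n with rfl | hn
  · simp [carlemanCoeff, carlemanB_one]
  · have hne : (n : ℂ) + 1 ≠ 0 := by exact_mod_cast Nat.succ_ne_zero n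
    have h := carlemanB_rec (n + 1) (by omega)
    rw [Finset.sum_range_succ, carlemanCoeff, if_neg (by omega), h]
    have hs : ∀ k ∈ Finset.range n, -(1 / ((k : ℂ) + 2)) * carlemanCoeff (n - k)
        = ((carlemanB (n + 1 - k - 1) / ((k : ℝ) + 2) : ℝ) : ℂ) := by
      intro k hk
      rw [Finset.mem_range] at hk
      rw [carlemanCoeff, if_neg (by omega), show n + 1 - k - 1 = n - k by omega]
      push_cast
      ring
    rw [Finset.sum_congr rfl hs, ← Complex.ofReal_sum, Nat.add_sub_cancel, Nat.sub_self,
      carlemanCoeff, if_pos rfl]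
    push_cast
    field_simp
    ring

/-- Partial fractions: the coefficient is `1/(k+2) - 1/(k+1)`, a difference of two shifted logarithm
series. -/
theorem hasSum_log_one_sub_mul {t : ℂ} (ht : ‖t‖ < 1) (ht0 : t ≠ 0) :
    HasSum (fun k : ℕ => -(1 / (((k : ℂ) + 1) * (k + 2))) * t ^ (k + 1))
      ((1 - 1 / t) * Complex.log (1 - t) - 1) := by
  have h := Complex.hasSum_taylorSeries_neg_log ht
  have h1 := (hasSum_nat_add_iff' 1).mpr h
  have h2 := (hasSum_nat_add_iff' 2).mpr h
  have h3 := (h2.div_const t).sub h1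
  have hval : (1 - 1 / t) * Complex.log (1 - t) - 1
      = (-Complex.log (1 - t) - ∑ i ∈ Finset.range 2, t ^ i / (i : ℂ)) / t
        - (-Complex.log (1 - t) - ∑ i ∈ Finset.range 1, t ^ i / (i : ℂ)) := by
    simp [Finset.sum_range_succ]
    field_simp
    ring
  rw [hval]
  refine h3.congr_fun fun k => ?_
  · have hk1 : (k : ℂ) + 1 ≠ 0 := by exact_mod_cast Nat.succ_ne_zero k
    have hk2 : (k : ℂ) + 2 ≠ 0 := by exact_mod_cast Nat.succ_ne_zero (k + 1)
    push_cast
    field_simp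
    ring

/-- By the differential equation `f exp(-p)` has zero derivative on the disc, so it keeps its value
`1` at the origin. -/
theorem tsum_carlemanCoeff_mul_pow {t : ℂ} (ht : ‖t‖ < 1) (ht0 : t ≠ 0) :
    ∑' n, carlemanCoeff n * t ^ n = Complex.exp ((1 - 1 / t) * Complex.log (1 - t) - 1) := by
  -- Division by zero makes `d 0 = 0`, so `p` has no constant term.
  let d : ℕ → ℂ := fun n => -(1 / ((n : ℂ) * (n + 1)))
  have hd : ∀ n, ‖d n‖ ≤ 1 := by
    intro n
    rcases Nat.eq_zero_or_pos n with rfl | hn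
    · simp [d]
    · have h : d n = -((1 / ((n : ℝ) * (n + 1)) : ℝ) : ℂ) := by simp [d]
      rw [h, norm_neg, Complex.norm_real, Real.norm_of_nonneg (by positivity)]
      have : (1 : ℝ) ≤ n := by exact_mod_cast hn
      exact div_le_one_of_le₀ (by nlinarith) (by positivity)
  set f : ℂ → ℂ := fun w => ∑' n, carlemanCoeff n * w ^ n with hf
  set p : ℂ → ℂ := fun w => ∑' n, d n * w ^ n with hp
  have hprod : ∀ z : ℂ, ‖z‖ < 1 → ∑' n, carlemanCoeff (n + 1) * (n + 1) * z ^ n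
      = (∑' n, d (n + 1) * (n + 1) * z ^ n) * f z := by
    intro z hz
    have hd' : ∀ n : ℕ, d (n + 1) * (n + 1) = -(1 / ((n : ℂ) + 2)) := by
      intro n
      have hk1 : (n : ℂ) + 1 ≠ 0 := by exact_mod_cast Nat.succ_ne_zero n
      have hk2 : (n : ℂ) + 2 ≠ 0 := by exact_mod_cast Nat.succ_ne_zero (n + 1)
      simp only [d]
      push_cast
      rw [show (n : ℂ) + 1 + 1 = n + 2 by ring]
      field_simp
    have hbd : ∀ n : ℕ, ‖-(1 / ((n : ℂ) + 2))‖ ≤ 1 := by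
      intro n
      have h : -(1 / ((n : ℂ) + 2)) = -((1 / ((n : ℝ) + 2) : ℝ) : ℂ) := by simp
      rw [h, norm_neg, Complex.norm_real, Real.norm_of_nonneg (by positivity)]
      have : (0 : ℝ) ≤ n := by positivity
      exact div_le_one_of_le₀ (by linarith) (by positivity)
    simp only [hd', hf]
    rw [tsum_mul_tsum_eq_tsum_sum_range_of_summable_norm
      (summable_norm_mul_pow_of_bounded hbd hz)
      (summable_norm_mul_pow_of_bounded norm_carlemanCoeff_le_one hz)]
    refine tsum_congr fun n => ?_
    rw [carlemanCoeff_succ_mul, Finset.sum_mul]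
    refine Finset.sum_congr rfl fun k hk => ?_
    rw [Finset.mem_range] at hk
    rw [mul_mul_mul_comm, ← pow_add, show k + (n - k) = n by omega]
  have hderiv : ∀ z ∈ Metric.ball (0 : ℂ) 1,
      HasDerivAt (fun w => f w * Complex.exp (-p w)) 0 z := by
    intro z hz
    rw [mem_ball_zero_iff] at hz
    have h1 := hasDerivAt_tsum_mul_pow_of_bounded norm_carlemanCoeff_le_one hz
    have h2 := hasDerivAt_tsum_mul_pow_of_bounded hd hz
    refine (h1.mul h2.neg.cexp).congr_deriv ?_
    rw [hprod z hz]
    simp only [hf]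
    simp only [Pi.neg_apply]
    ring
  have hconst := IsOpen.is_const_of_deriv_eq_zero Metric.isOpen_ball
    (convex_ball (0 : ℂ) 1).isPreconnected
    (fun z hz => (hderiv z hz).differentiableAt.differentiableWithinAt)
    (fun z hz => (hderiv z hz).deriv)
    (show t ∈ Metric.ball (0 : ℂ) 1 by rwa [mem_ball_zero_iff])
    (show (0 : ℂ) ∈ Metric.ball (0 : ℂ) 1 by simp)
  have hf0 : f 0 = 1 := by
    simp only [hf]
    rw [tsum_eq_single 0 (fun n hn => by simp [hn])]
    simp [carlemanCoeff]
  have hp0 : p 0 = 0 := by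
    simp only [hp]
    rw [tsum_eq_single 0 (fun n hn => by simp [hn])]
    simp [d]
  have hpt : p t = (1 - 1 / t) * Complex.log (1 - t) - 1 := by
    simp only [hp]
    have hs := (summable_norm_mul_pow_of_bounded hd ht).of_norm
    rw [hs.tsum_eq_zero_add, ← (hasSum_log_one_sub_mul ht ht0).tsum_eq]
    simp only [d]
    push_cast
    simp [add_assoc, one_add_one_eq_two]
  simp only [hf0, hp0, neg_zero, Complex.exp_zero, mul_one] at hconst
  rw [Complex.exp_neg, mul_inv_eq_one₀ (Complex.exp_ne_zero _)] at hconst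
  rw [← hpt]
  exact hconst

theorem norm_exp_sub_sum_carlemanCoeff_le {t : ℂ} (ht : ‖t‖ ≤ 1 / 2) (ht0 : t ≠ 0) (N : ℕ) :
    ‖Complex.exp ((1 - 1 / t) * Complex.log (1 - t) - 1)
      - ∑ n ∈ Finset.range N, carlemanCoeff n * t ^ n‖ ≤ 2 * ‖t‖ ^ N := by
  have ht1 : ‖t‖ < 1 := by linarith
  have hs := summable_norm_mul_pow_of_bounded norm_carlemanCoeff_le_one ht1
  rw [← tsum_carlemanCoeff_mul_pow ht1 ht0, ← hs.of_norm.sum_add_tsum_nat_add N,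
    add_sub_cancel_left]
  have hg := (hasSum_geometric_of_lt_one (norm_nonneg t) ht1).mul_left (‖t‖ ^ N)
  refine (tsum_of_norm_bounded hg fun n => ?_).trans ?_
  · rw [norm_mul, norm_pow, pow_add, mul_comm (‖t‖ ^ N)]
    exact mul_le_of_le_one_left (by positivity) (norm_carlemanCoeff_le_one _)
  · rw [mul_comm]
    refine mul_le_mul_of_nonneg_right ?_ (by positivity)
    rw [inv_le_comm₀ (by linarith) (by norm_num)]
    linarith

/-! ### Cauchy's theorem in the upper half-plane -/

/-- Close the segment to the rectangle with top side at height `R`. The other three sides have total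
length `4R` and the integrand there is at most `C / R²`. Continuity up to the axis makes
indentations unnecessary. -/
theorem tendsto_intervalIntegral_zero_of_norm_le_div_sq {E : ℂ → ℂ} {C ρ : ℝ}
    (hc : ContinuousOn E {z | 0 ≤ z.im}) (hd : DifferentiableOn ℂ E {z | 0 < z.im})
    (hE : ∀ z : ℂ, 0 ≤ z.im → ρ ≤ ‖z‖ → ‖E z‖ ≤ C / ‖z‖ ^ 2) :
    Tendsto (fun R : ℝ => ∫ x in -R..R, E x) atTop (𝓝 0) := by
  have hbound : ∀ᶠ R : ℝ in atTop, ‖∫ x in -R..R, E x‖ ≤ 4 * C / R := by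
    filter_upwards [eventually_ge_atTop ρ, eventually_gt_atTop 0] with R hRρ hR
    have hnorm : ∀ z : ℂ, 0 ≤ z.im → R ≤ ‖z‖ → ‖E z‖ ≤ C / R ^ 2 := by
      intro z hz hRz
      refine (hE z hz (hRρ.trans hRz)).trans ?_
      have hC : 0 ≤ C := by
        have h := (norm_nonneg _).trans (hE z hz (hRρ.trans hRz))
        by_contra! hneg
        have : 0 < ‖z‖ ^ 2 := by have := hR.trans_le hRz; positivity
        exact absurd h (not_le.mpr (div_neg_of_neg_of_pos hneg this))
      gcongr
    have h := Complex.integral_boundary_rect_eq_zero_of_continuousOn_of_differentiableOn E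
      (-R : ℂ) ((R : ℂ) + R * Complex.I) (hc.mono ?_) (hd.mono ?_)
    · simp only [Complex.neg_re, Complex.ofReal_re, Complex.add_re, Complex.mul_re, Complex.I_re,
        mul_zero, Complex.ofReal_im, Complex.I_im, mul_one, sub_self, add_zero, Complex.neg_im,
        neg_zero, Complex.ofReal_zero, zero_mul, Complex.add_im, Complex.mul_im, zero_add,
        smul_eq_mul] at h
      have hI : (∫ x in -R..R, E x) = (∫ x in -R..R, E (x + R * Complex.I))
          - Complex.I * (∫ y in (0 : ℝ)..R, E (R + y * Complex.I))
          + Complex.I * ∫ y in (0 : ℝ)..R, E ((-R : ℝ) + y * Complex.I) := by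
        linear_combination h
      have h1 : ‖∫ x in -R..R, E (x + R * Complex.I)‖ ≤ C / R ^ 2 * |R - -R| :=
        intervalIntegral.norm_integral_le_of_norm_le_const fun x _ => by
          refine hnorm _ (by simp [hR.le]) ?_
          have := Complex.abs_im_le_norm ((x : ℂ) + R * Complex.I)
          simpa [abs_of_pos hR] using this
      have h2 : ‖∫ y in (0 : ℝ)..R, E (R + y * Complex.I)‖ ≤ C / R ^ 2 * |R - 0| :=
        intervalIntegral.norm_integral_le_of_norm_le_const fun y hy => by
          rw [Set.uIoc_of_le hR.le] at hy
          refine hnorm _ (by simp [hy.1.le]) ?_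
          have := Complex.abs_re_le_norm ((R : ℂ) + y * Complex.I)
          simpa [abs_of_pos hR] using this
      have h3 : ‖∫ y in (0 : ℝ)..R, E ((-R : ℝ) + y * Complex.I)‖ ≤ C / R ^ 2 * |R - 0| :=
        intervalIntegral.norm_integral_le_of_norm_le_const fun y hy => by
          rw [Set.uIoc_of_le hR.le] at hy
          refine hnorm _ (by simp [hy.1.le]) ?_
          have := Complex.abs_re_le_norm (((-R : ℝ) : ℂ) + y * Complex.I)
          simpa [abs_of_pos hR] using this
      rw [abs_of_nonneg (by linarith)] at h1 h2 h3
      rw [hI]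
      refine (norm_add_le_of_le (norm_sub_le_of_le h1 ((norm_mul _ _).trans_le ?_))
        ((norm_mul _ _).trans_le ?_)).trans (b := C / R ^ 2 * (R - -R) + C / R ^ 2 * (R - 0)
          + C / R ^ 2 * (R - 0)) ?_
      · rwa [Complex.norm_I, one_mul]
      · rwa [Complex.norm_I, one_mul]
      · apply le_of_eq
        field_simp
        ring
    · intro z hz
      have := hz.2
      simp [Set.uIcc_of_le hR.le] at this
      exact this.1
    · intro z hz
      have := hz.2
      simp [min_eq_left hR.le] at this
      exact this.1
  refine squeeze_zero_norm' hbound ?_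
  exact tendsto_const_nhds.div_atTop tendsto_id

/-! ### The function `P` and its boundary values -/

/-- `z log z` with the logarithm cut along the negative imaginary axis, up to a multiple of `z`. -/
noncomputable def upperMulLog (z : ℂ) : ℂ := z * Complex.log (-Complex.I * z)

/-- Multiplication by `-I` turns the closed upper half-plane into the closed right one, which meets
the branch cut only at the origin. -/
theorem neg_I_mul_mem_slitPlane {z : ℂ} (hz : 0 ≤ z.im) (h0 : z ≠ 0) :
    -Complex.I * z ∈ Complex.slitPlane := by
  rw [Complex.mem_slitPlane_iff]
  simp
  rcases hz.lt_or_eq with h | h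
  · exact Or.inl h
  · right
    intro hre
    exact h0 (Complex.ext hre h.symm)

theorem continuousAt_mul_log_zero : ContinuousAt (fun z : ℂ => z * Complex.log z) 0 := by
  rw [ContinuousAt, Complex.log_zero, mul_zero]
  have hlim : Tendsto (fun z : ℂ => |‖z‖ * Real.log ‖z‖| + ‖z‖ * Real.pi) (𝓝 0) (𝓝 0) := by
    have h : Continuous fun z : ℂ => |‖z‖ * Real.log ‖z‖| + ‖z‖ * Real.pi :=
      (Real.continuous_mul_log.comp continuous_norm).abs.add (continuous_norm.mul continuous_const)
    simpa using h.tendsto 0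
  refine squeeze_zero_norm (fun z => ?_) hlim
  rw [norm_mul, abs_mul, abs_of_nonneg (norm_nonneg z), ← mul_add]
  refine mul_le_mul_of_nonneg_left ?_ (norm_nonneg z)
  refine (Complex.norm_le_abs_re_add_abs_im _).trans ?_
  rw [Complex.log_re, Complex.log_im]
  gcongr
  exact Complex.abs_arg_le_pi z

theorem continuousAt_upperMulLog {z : ℂ} (hz : 0 ≤ z.im) : ContinuousAt upperMulLog z := by
  rcases eq_or_ne z 0 with rfl | h0
  · have h : upperMulLog = fun z => Complex.I * ((-Complex.I * z) * Complex.log (-Complex.I * z)) := by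
      funext z
      rw [upperMulLog]
      linear_combination z * Complex.log (-Complex.I * z) * (Complex.I_mul_I)
    rw [h]
    refine continuousAt_const.mul ?_
    exact ContinuousAt.comp (g := fun z : ℂ => z * Complex.log z)
      (f := fun z : ℂ => -Complex.I * z) (x := 0)
      (by simpa using continuousAt_mul_log_zero) (by fun_prop)
  · exact continuousAt_id.mul
      ((continuousAt_const.mul continuousAt_id).clog (neg_I_mul_mem_slitPlane hz h0))

theorem differentiableAt_upperMulLog {z : ℂ} (hz : 0 < z.im) :
    DifferentiableAt ℂ upperMulLog z := by
  have h0 : z ≠ 0 := by rintro rfl; simp at hz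
  exact differentiableAt_id.mul
    ((differentiableAt_id.const_mul _).clog (neg_I_mul_mem_slitPlane hz.le h0))

theorem upperMulLog_ofReal (x : ℝ) :
    upperMulLog x = (x * Real.log x : ℝ) - (Real.pi / 2 * |x| : ℝ) * Complex.I := by
  rw [upperMulLog]
  rcases lt_trichotomy x 0 with h | rfl | h
  · have h1 : -Complex.I * (x : ℂ) = ((-x : ℝ) : ℂ) * Complex.I := by push_cast; ring
    rw [h1, Complex.log_ofReal_mul (by linarith) Complex.I_ne_zero, Complex.log_I, Real.log_neg_eq_log,
      abs_of_neg h]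
    push_cast
    ring
  · simp
  · have h1 : -Complex.I * (x : ℂ) = (x : ℂ) * (-Complex.I) := by ring
    rw [h1, Complex.log_ofReal_mul h (by simp), Complex.log_neg_I, abs_of_pos h]
    push_cast
    ring

/-- The function `z (1 - 1 / z) ^ (1 - z)` on the closed upper half-plane. -/
noncomputable def carlemanP (z : ℂ) : ℂ :=
  Complex.I * Complex.exp (upperMulLog z - upperMulLog (z - 1))

theorem continuousAt_carlemanP {z : ℂ} (hz : 0 ≤ z.im) : ContinuousAt carlemanP z := by
  refine continuousAt_const.mul ((continuousAt_upperMulLog hz).sub ?_).cexp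
  exact ContinuousAt.comp (g := upperMulLog) (f := fun z : ℂ => z - 1)
    (continuousAt_upperMulLog (by simpa using hz)) (by fun_prop)

theorem differentiableAt_carlemanP {z : ℂ} (hz : 0 < z.im) : DifferentiableAt ℂ carlemanP z := by
  refine ((differentiableAt_upperMulLog hz).sub ?_).cexp.const_mul _
  exact DifferentiableAt.comp (g := upperMulLog) (f := fun z : ℂ => z - 1) z
    (differentiableAt_upperMulLog (by simpa using hz)) (by fun_prop)

/-- The cosine collects the arguments at `x` and `x - 1`: its angle is `±π/2` outside `[0, 1]` and
`π x - π/2` inside. -/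
theorem carlemanP_ofReal_im (x : ℝ) :
    (carlemanP x).im = Real.exp (x * Real.log x - (x - 1) * Real.log (x - 1))
      * Real.cos (Real.pi / 2 * (|x| - |x - 1|)) := by
  have h : upperMulLog x - upperMulLog (x - 1)
      = (x * Real.log x - (x - 1) * Real.log (x - 1) : ℝ)
        + (-(Real.pi / 2 * (|x| - |x - 1|)) : ℝ) * Complex.I := by
    rw [← Complex.ofReal_one, ← Complex.ofReal_sub, upperMulLog_ofReal, upperMulLog_ofReal]
    push_cast
    ring
  rw [carlemanP, h, Complex.I_mul_im, Complex.exp_re]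
  simp only [Complex.add_re, Complex.add_im, Complex.re_ofReal_mul, Complex.im_ofReal_mul,
    Complex.ofReal_re, Complex.ofReal_im, Complex.I_re, Complex.I_im, mul_zero, mul_one, add_zero,
    zero_add, Real.cos_neg]

theorem carlemanP_ofReal_im_of_mem {x : ℝ} (hx : x ∈ Set.Icc (0 : ℝ) 1) :
    (carlemanP x).im = Real.pi * carlemanG x := by
  obtain ⟨h0, h1⟩ := hx
  have hpow : ∀ y : ℝ, 0 ≤ y → y ^ y = Real.exp (y * Real.log y) := by
    intro y hy
    -- At `y = 0` both sides are `1`, matching the convention for `0 ^ 0`.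
    rcases hy.eq_or_lt with rfl | hy
    · simp
    · rw [Real.rpow_def_of_pos hy, mul_comm]
  rw [carlemanP_ofReal_im, carlemanG, hpow x h0, hpow (1 - x) (by linarith), abs_of_nonneg h0,
    abs_of_nonpos (by linarith), show Real.pi / 2 * (x - -(x - 1)) = Real.pi * x - Real.pi / 2 by ring,
    Real.cos_sub_pi_div_two, show x - 1 = -(1 - x) by ring, Real.log_neg_eq_log,
    show x * Real.log x - -(1 - x) * Real.log (1 - x)
      = x * Real.log x + (1 - x) * Real.log (1 - x) by ring, Real.exp_add]
  have := Real.pi_ne_zero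
  field_simp

theorem carlemanP_ofReal_im_of_nonpos {x : ℝ} (hx : x ≤ 0) : (carlemanP x).im = 0 := by
  rw [carlemanP_ofReal_im, abs_of_nonpos hx, abs_of_nonpos (by linarith),
    show Real.pi / 2 * (-x - -(x - 1)) = -(Real.pi / 2) by ring, Real.cos_neg, Real.cos_pi_div_two,
    mul_zero]

theorem carlemanP_ofReal_im_of_one_le {x : ℝ} (hx : 1 ≤ x) : (carlemanP x).im = 0 := by
  rw [carlemanP_ofReal_im, abs_of_nonneg (by linarith), abs_of_nonneg (by linarith),
    show Real.pi / 2 * (x - (x - 1)) = Real.pi / 2 by ring, Real.cos_pi_div_two, mul_zero]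

/-- For `‖z‖ ≥ 2` the point `1 - z⁻¹` lies in the open right half-plane, so its argument and that of
`-I * z` add up without crossing the cut and the logarithm is additive. The factor `I` in
`carlemanP` undoes the rotation. -/
theorem carlemanP_eq_mul_exp {z : ℂ} (hz : 0 ≤ z.im) (h : 2 ≤ ‖z‖) :
    carlemanP z = z * Complex.exp ((1 - z) * Complex.log (1 - z⁻¹)) := by
  have h0 : z ≠ 0 := by rintro rfl; norm_num at h
  have hinv : ‖z⁻¹‖ ≤ 1 / 2 := by
    rw [norm_inv, one_div]
    exact inv_anti₀ (by norm_num) h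
  have hre : 0 < (1 - z⁻¹).re := by
    have := (Complex.abs_re_le_norm z⁻¹).trans hinv
    rw [Complex.sub_re, Complex.one_re]
    linarith [(abs_le.mp this).2]
  have hne : 1 - z⁻¹ ≠ 0 := by
    intro he
    rw [he] at hre
    simp at hre
  have ha1 : |(-Complex.I * z).arg| ≤ Real.pi / 2 := by
    rw [Complex.abs_arg_le_pi_div_two_iff]
    simpa using hz
  have ha2 : |(1 - z⁻¹).arg| < Real.pi / 2 := Complex.abs_arg_lt_pi_div_two_iff.mpr (Or.inl hre)
  rw [abs_le] at ha1
  rw [abs_lt] at ha2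
  have hIz : -Complex.I * z ≠ 0 := mul_ne_zero (by simp) h0
  have hlog : Complex.log (-Complex.I * (z - 1))
      = Complex.log (-Complex.I * z) + Complex.log (1 - z⁻¹) := by
    rw [← Complex.log_mul hIz hne ⟨by linarith, by linarith⟩]
    congr 1
    field_simp
  rw [carlemanP, upperMulLog, upperMulLog, hlog,
    show z * Complex.log (-Complex.I * z)
      - (z - 1) * (Complex.log (-Complex.I * z) + Complex.log (1 - z⁻¹))
      = Complex.log (-Complex.I * z) + (1 - z) * Complex.log (1 - z⁻¹) by ring, Complex.exp_add,
    Complex.exp_log hIz]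
  linear_combination -z * Complex.exp ((1 - z) * Complex.log (1 - z⁻¹)) * Complex.I_mul_I

theorem continuous_carlemanP_ofReal : Continuous fun x : ℝ => carlemanP x :=
  continuous_iff_continuousAt.mpr fun x =>
    ContinuousAt.comp (g := carlemanP) (f := fun x : ℝ => (x : ℂ))
      (continuousAt_carlemanP (by simp)) Complex.continuous_ofReal.continuousAt

theorem continuousOn_carlemanG : ContinuousOn carlemanG (Set.Icc 0 1) := by
  have h : Continuous fun x : ℝ => (carlemanP x).im / Real.pi :=
    (Complex.continuous_im.comp continuous_carlemanP_ofReal).div_const _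
  refine h.continuousOn.congr fun x hx => ?_
  simp only [carlemanP_ofReal_im_of_mem hx, mul_div_cancel_left₀ _ Real.pi_ne_zero]

theorem carlemanG_pos {s : ℝ} (hs : s ∈ Set.Ioo (0 : ℝ) 1) : 0 < carlemanG s := by
  have h1 := Real.rpow_pos_of_pos hs.1 s
  have h2 := Real.rpow_pos_of_pos (sub_pos.mpr hs.2) (1 - s)
  have h3 : 0 < Real.sin (Real.pi * s) :=
    Real.sin_pos_of_pos_of_lt_pi (mul_pos Real.pi_pos hs.1)
      (mul_lt_of_lt_one_right Real.pi_pos hs.2)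
  have := Real.pi_pos
  rw [carlemanG]
  positivity

theorem carlemanG_one_sub (s : ℝ) : carlemanG (1 - s) = carlemanG s := by
  rw [carlemanG, carlemanG, sub_sub_cancel, mul_sub, mul_one, Real.sin_pi_sub]
  ring

/-! ### The remainder at infinity and the moment formula -/

/-- The difference of `z ^ m P(z)` and its expansion at infinity, up to an error `O(z⁻²)`. -/
noncomputable def carlemanRemainder (m : ℕ) (z : ℂ) : ℂ :=
  carlemanP z * z ^ m - (Real.exp 1 : ℝ) *
    (∑ n ∈ Finset.range (m + 2), carlemanCoeff n * z ^ (m + 1 - n)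
      - (carlemanB (m + 2) : ℝ) * (z + Complex.I)⁻¹)

theorem norm_le_norm_add_I {z : ℂ} (hz : 0 ≤ z.im) : ‖z‖ ≤ ‖z + Complex.I‖ := by
  rw [← sq_le_sq₀ (norm_nonneg _) (norm_nonneg _), Complex.sq_norm, Complex.sq_norm,
    Complex.normSq_apply, Complex.normSq_apply]
  simp
  nlinarith

theorem add_I_ne_zero_of_im_nonneg {z : ℂ} (hz : 0 ≤ z.im) : z + Complex.I ≠ 0 := by
  intro h
  have := congrArg Complex.im h
  simp at this
  linarith

/-- Replacing `z⁻¹` by `(z + I)⁻¹` moves the pole out of the closed half-plane and costs only `I /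
(z (z + I))`, which is `O(z⁻²)`. -/
theorem norm_carlemanRemainder_le (m : ℕ) {z : ℂ} (hz : 0 ≤ z.im) (h2 : 2 ≤ ‖z‖) :
    ‖carlemanRemainder m z‖ ≤ 3 * Real.exp 1 / ‖z‖ ^ 2 := by
  have h0 : z ≠ 0 := by rintro rfl; norm_num at h2
  have hI := add_I_ne_zero_of_im_nonneg hz
  have hpos : 0 < ‖z‖ := by linarith
  set X : ℂ := (1 - 1 / z⁻¹) * Complex.log (1 - z⁻¹) with hX
  have hP : carlemanP z = z * ((Real.exp 1 : ℝ) * Complex.exp (X - 1)) := by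
    rw [carlemanP_eq_mul_exp hz h2, Complex.ofReal_exp, ← Complex.exp_add, hX, one_div, inv_inv]
    simp
  -- The last term, `n = m + 2`, is the one that produces `z⁻¹`.
  have hsum : z ^ (m + 1) * ∑ n ∈ Finset.range (m + 3), carlemanCoeff n * z⁻¹ ^ n
      = ∑ n ∈ Finset.range (m + 2), carlemanCoeff n * z ^ (m + 1 - n)
        - (carlemanB (m + 2) : ℝ) * z⁻¹ := by
    rw [Finset.sum_range_succ, mul_add, Finset.mul_sum, sub_eq_add_neg]
    congr 1
    · refine Finset.sum_congr rfl fun n hn => ?_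
      rw [Finset.mem_range] at hn
      rw [← pow_sub_mul_pow z (show n ≤ m + 1 by omega), inv_pow]
      field_simp
    · rw [carlemanCoeff, if_neg (by omega), pow_succ z⁻¹ (m + 1), inv_pow]
      field_simp
  have hE : carlemanRemainder m z = (Real.exp 1 : ℝ) *
      (z ^ (m + 1) * (Complex.exp (X - 1)
        - ∑ n ∈ Finset.range (m + 3), carlemanCoeff n * z⁻¹ ^ n)
        - (carlemanB (m + 2) : ℝ) * (Complex.I * (z⁻¹ * (z + Complex.I)⁻¹))) := by
    rw [mul_sub (z ^ (m + 1)), hsum, carlemanRemainder, hP,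
      show Complex.I * (z⁻¹ * (z + Complex.I)⁻¹) = z⁻¹ - (z + Complex.I)⁻¹ by field_simp; ring]
    ring
  have hinv : ‖z⁻¹‖ ≤ 1 / 2 := by
    rw [norm_inv, one_div]
    exact inv_anti₀ (by norm_num) h2
  have h3 : ‖z ^ (m + 1) * (Complex.exp (X - 1)
      - ∑ n ∈ Finset.range (m + 3), carlemanCoeff n * z⁻¹ ^ n)‖ ≤ 2 / ‖z‖ ^ 2 := by
    rw [norm_mul, norm_pow]
    refine (mul_le_mul_of_nonneg_left
      (norm_exp_sub_sum_carlemanCoeff_le hinv (inv_ne_zero h0) (m + 3)) (by positivity)).trans ?_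
    apply le_of_eq
    rw [norm_inv, inv_pow, show m + 3 = (m + 1) + 2 by rfl, pow_add _ (m + 1) 2]
    field_simp
  have h4 : ‖((carlemanB (m + 2) : ℝ) : ℂ) * (Complex.I * (z⁻¹ * (z + Complex.I)⁻¹))‖
      ≤ 1 / ‖z‖ ^ 2 := by
    rw [norm_mul, Complex.norm_real, norm_mul, Complex.norm_I, one_mul, norm_mul, norm_inv, norm_inv]
    refine (mul_le_of_le_one_left (by positivity) (abs_carlemanB_le_one _)).trans ?_
    rw [one_div, sq, mul_inv]
    have := norm_le_norm_add_I hz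
    gcongr
  rw [hE, norm_mul, Complex.norm_real, Real.norm_of_nonneg (Real.exp_pos 1).le]
  refine (mul_le_mul_of_nonneg_left (norm_sub_le_of_le h3 h4) (Real.exp_pos 1).le).trans ?_
  apply le_of_eq
  ring

theorem continuousOn_carlemanRemainder (m : ℕ) :
    ContinuousOn (carlemanRemainder m) {z | 0 ≤ z.im} := by
  intro z hz
  have hI := add_I_ne_zero_of_im_nonneg hz
  have hP := continuousAt_carlemanP hz
  refine ContinuousAt.continuousWithinAt ?_
  unfold carlemanRemainder
  fun_prop (disch := assumption)

theorem differentiableOn_carlemanRemainder (m : ℕ) :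
    DifferentiableOn ℂ (carlemanRemainder m) {z | 0 < z.im} := by
  intro z hz
  have hI := add_I_ne_zero_of_im_nonneg (le_of_lt hz)
  have hP := differentiableAt_carlemanP hz
  refine DifferentiableAt.differentiableWithinAt ?_
  unfold carlemanRemainder
  fun_prop (disch := assumption)

/-- The subtracted polynomial is real on the axis, so only `P` and the Cauchy kernel, of total mass
`π`, survive. -/
theorem carlemanRemainder_ofReal_im (m : ℕ) (x : ℝ) :
    (carlemanRemainder m x).im =
      (carlemanP x).im * x ^ m - Real.exp 1 * carlemanB (m + 2) * (1 + x ^ 2)⁻¹ := by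
  have hc : ∀ n, carlemanCoeff n = ((if n = 0 then 1 else -carlemanB n : ℝ) : ℂ) := by
    intro n
    rw [carlemanCoeff]
    split_ifs <;> simp
  have hinv : ((x : ℂ) + Complex.I)⁻¹.im = -(1 + x ^ 2)⁻¹ := by
    rw [Complex.inv_im, Complex.normSq_apply]
    simp
    rw [neg_div, one_div]
    ring_nf
  have hsum : (∑ n ∈ Finset.range (m + 2), carlemanCoeff n * (x : ℂ) ^ (m + 1 - n)).im = 0 := by
    rw [Complex.im_sum]
    refine Finset.sum_eq_zero fun n _ => ?_
    rw [hc, ← Complex.ofReal_pow, ← Complex.ofReal_mul, Complex.ofReal_im]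
  rw [carlemanRemainder, Complex.sub_im, ← Complex.ofReal_pow, Complex.im_mul_ofReal,
    Complex.im_ofReal_mul, Complex.sub_im, Complex.im_ofReal_mul, hsum, hinv]
  ring

theorem integral_carlemanP_im_mul_pow (m : ℕ) {R : ℝ} (hR : 1 ≤ R) :
    ∫ x in -R..R, (carlemanP x).im * x ^ m
      = Real.pi * ∫ s in (0 : ℝ)..1, carlemanG s * s ^ m := by
  have hsupp : (Function.support fun x : ℝ => (carlemanP x).im * x ^ m) ⊆ Set.Ioc 0 1 := by
    intro x hx
    by_contra hn
    apply hx
    rcases le_or_gt x 0 with h | h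
    · simp [carlemanP_ofReal_im_of_nonpos h]
    · have h1 : 1 ≤ x := by
        by_contra! h1
        exact hn ⟨h, h1.le⟩
      simp [carlemanP_ofReal_im_of_one_le h1]
  rw [intervalIntegral.integral_eq_integral_of_support_subset
      (hsupp.trans (Set.Ioc_subset_Ioc (by linarith) hR)),
    ← intervalIntegral.integral_eq_integral_of_support_subset hsupp,
    ← intervalIntegral.integral_const_mul]
  refine intervalIntegral.integral_congr fun x hx => ?_
  rw [Set.uIcc_of_le zero_le_one] at hx
  simp only [carlemanP_ofReal_im_of_mem hx, mul_assoc]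

theorem exp_one_mul_carlemanB_eq_integral (m : ℕ) :
    Real.exp 1 * carlemanB (m + 2) = ∫ s in (0 : ℝ)..1, carlemanG s * s ^ m := by
  have hlim := (Complex.continuous_im.tendsto 0).comp
    (tendsto_intervalIntegral_zero_of_norm_le_div_sq (continuousOn_carlemanRemainder m)
      (differentiableOn_carlemanRemainder m)
      fun z hz h2 => norm_carlemanRemainder_le m hz h2)
  have hcont : Continuous fun x : ℝ => carlemanRemainder m x :=
    continuousOn_univ.mp ((continuousOn_carlemanRemainder m).comp
      Complex.continuous_ofReal.continuousOn fun x _ => by simp)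
  have hcontP : Continuous fun x : ℝ => (carlemanP x).im * x ^ m :=
    (Complex.continuous_im.comp continuous_carlemanP_ofReal).mul (continuous_pow m)
  have hcontinv : Continuous fun x : ℝ => (1 + x ^ 2)⁻¹ :=
    Continuous.inv₀ (by fun_prop) fun x => by positivity
  have heq : (fun R : ℝ => Real.pi * (∫ s in (0 : ℝ)..1, carlemanG s * s ^ m)
      - Real.exp 1 * carlemanB (m + 2) * (2 * Real.arctan R))
      =ᶠ[atTop] (Complex.im ∘ fun R : ℝ => ∫ x in -R..R, carlemanRemainder m x) := by
    filter_upwards [eventually_ge_atTop 1] with R hR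
    have him : (∫ x in -R..R, carlemanRemainder m x).im
        = ∫ x in -R..R, (carlemanRemainder m x).im :=
      (Complex.imCLM.intervalIntegral_comp_comm (hcont.intervalIntegrable _ _)).symm
    rw [Function.comp_apply, him]
    simp only [carlemanRemainder_ofReal_im]
    rw [intervalIntegral.integral_sub (hcontP.intervalIntegrable _ _)
        ((hcontinv.const_mul _).intervalIntegrable _ _),
      intervalIntegral.integral_const_mul, integral_inv_one_add_sq,
      integral_carlemanP_im_mul_pow m hR, Real.arctan_neg]
    ring
  have hlim2 := hlim.congr' heq.symm
  have hatan := Real.tendsto_arctan_atTop.mono_right nhdsWithin_le_nhds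
  have hlim3 := ((hatan.const_mul 2).const_mul (Real.exp 1 * carlemanB (m + 2))).const_sub
    (Real.pi * ∫ s in (0 : ℝ)..1, carlemanG s * s ^ m)
  have h := tendsto_nhds_unique hlim2 hlim3
  rw [Complex.zero_im] at h
  have hpi := Real.pi_ne_zero
  apply mul_left_cancel₀ hpi
  linear_combination h

/-! ### Ratios of consecutive moments -/

/-- On `[1 - δ, 1]` the factor `1 - s` is at most `δ`. The rest contributes `O((1 - δ) ^ m)`,
negligible against the lower bound `c ^ m * κ` from the mass of `w` on `[c, 1]`, as `c > 1 - δ`. -/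
theorem tendsto_moment_ratio {w : ℝ → ℝ} (hw : ContinuousOn w (Set.Icc 0 1))
    (hpos : ∀ s ∈ Set.Ioo (0 : ℝ) 1, 0 < w s) :
    Tendsto (fun m : ℕ => (∫ s in (0 : ℝ)..1, w s * s ^ (m + 1)) / ∫ s in (0 : ℝ)..1, w s * s ^ m)
      atTop (𝓝 1) := by
  set M : ℕ → ℝ := fun m => ∫ s in (0 : ℝ)..1, w s * s ^ m with hM
  have hnonneg : ∀ s ∈ Set.Icc (0 : ℝ) 1, 0 ≤ w s := by
    have h := closure_Ioo (zero_ne_one (α := ℝ))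
    intro s hs
    have hcl : s ∈ closure (Set.Ioo (0 : ℝ) 1) := by rwa [h]
    have hcw : ContinuousWithinAt w (Set.Ioo 0 1) s :=
      (hw s hs).mono Set.Ioo_subset_Icc_self
    have := mem_closure_iff_nhdsWithin_neBot.mp hcl
    exact ge_of_tendsto hcw (eventually_nhdsWithin_of_forall fun x hx => (hpos x hx).le)
  have hint : ∀ m : ℕ, IntervalIntegrable (fun s => w s * s ^ m) MeasureTheory.volume 0 1 := by
    intro m
    refine ContinuousOn.intervalIntegrable ?_
    rw [Set.uIcc_of_le zero_le_one]
    exact hw.mul (continuousOn_pow m)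
  have hMpos : ∀ m, 0 < M m := fun m =>
    intervalIntegral.intervalIntegral_pos_of_pos_on (hint m)
      (fun s hs => mul_pos (hpos s hs) (pow_pos hs.1 m)) zero_lt_one
  have hle : ∀ m, M (m + 1) ≤ M m := fun m =>
    intervalIntegral.integral_mono_on zero_le_one (hint _) (hint _) fun s hs =>
      mul_le_mul_of_nonneg_left (pow_le_pow_of_le_one hs.1 hs.2 m.le_succ) (hnonneg s hs)
  rw [Metric.tendsto_atTop']
  intro ε hε
  -- Half of `ε` is left for the geometric term; the cap `1 / 2` keeps `1 - δ` positive.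
  set δ : ℝ := min (ε / 2) (1 / 2) with hδ
  have hδ0 : 0 < δ := by positivity
  have hδ1 : δ ≤ 1 / 2 := min_le_right _ _
  have hδε : δ ≤ ε / 2 := min_le_left _ _
  set c : ℝ := 1 - δ / 2 with hc
  have hc0 : 0 < c := by linarith
  have hc1 : c < 1 := by linarith
  set κ : ℝ := ∫ s in c..1, w s with hκ
  have hintc : ∀ m : ℕ, IntervalIntegrable (fun s => w s * s ^ m) MeasureTheory.volume c 1 := by
    intro m
    refine (hint m).mono_set ?_
    rw [Set.uIcc_of_le hc1.le, Set.uIcc_of_le zero_le_one]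
    exact Set.Icc_subset_Icc_left hc0.le
  have hintc0 : IntervalIntegrable w MeasureTheory.volume c 1 := by simpa using hintc 0
  have hκ0 : 0 < κ := intervalIntegral.intervalIntegral_pos_of_pos_on hintc0
    (fun s hs => hpos s ⟨hc0.trans hs.1, hs.2⟩) hc1
  have hlower : ∀ m, c ^ m * κ ≤ M m := by
    intro m
    have h1 : c ^ m * κ ≤ ∫ s in c..1, w s * s ^ m := by
      rw [hκ, ← intervalIntegral.integral_const_mul]
      refine intervalIntegral.integral_mono_on hc1.le (hintc0.const_mul _) (hintc m) fun s hs => ?_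
      rw [mul_comm]
      exact mul_le_mul_of_nonneg_left (pow_le_pow_left₀ hc0.le hs.1 m)
        (hnonneg s ⟨hc0.le.trans hs.1, hs.2⟩)
    refine h1.trans (intervalIntegral.integral_mono_interval hc0.le hc1.le le_rfl ?_ (hint m))
    refine (MeasureTheory.ae_restrict_iff' measurableSet_Ioc).mpr (.of_forall fun s hs => ?_)
    exact mul_nonneg (hnonneg s ⟨hs.1.le, hs.2⟩) (pow_nonneg hs.1.le m)
  have hupper : ∀ m, M m - M (m + 1) ≤ δ * M m + (1 - δ) ^ m * M 0 := by
    intro m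
    rw [hM]
    simp only
    rw [← intervalIntegral.integral_sub (hint m) (hint (m + 1)),
      ← intervalIntegral.integral_const_mul, ← intervalIntegral.integral_const_mul,
      ← intervalIntegral.integral_add ((hint m).const_mul _) ((hint 0).const_mul _)]
    refine intervalIntegral.integral_mono_on zero_le_one ((hint m).sub (hint (m + 1)))
      (((hint m).const_mul _).add ((hint 0).const_mul _)) fun s hs => ?_
    have hs0 := pow_nonneg hs.1 m
    have hd0 : 0 ≤ (1 - δ) ^ m := pow_nonneg (by linarith) m
    have hpt : s ^ m * (1 - s) ≤ δ * s ^ m + (1 - δ) ^ m := by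
      rcases le_total (1 - δ) s with h | h
      · nlinarith
      · have := pow_le_pow_left₀ hs.1 h m
        nlinarith [hs.1]
    have := mul_le_mul_of_nonneg_left hpt (hnonneg s hs)
    rw [pow_succ, pow_zero]
    linarith
  have hq0 : 0 ≤ (1 - δ) / c := div_nonneg (by linarith) hc0.le
  have hq1 : (1 - δ) / c < 1 := by
    rw [div_lt_one hc0]
    linarith
  have hgeom : Tendsto (fun m : ℕ => ((1 - δ) / c) ^ m * (M 0 / κ)) atTop (𝓝 0) := by
    simpa using (tendsto_pow_atTop_nhds_zero_of_lt_one hq0 hq1).mul_const (M 0 / κ)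
  obtain ⟨N, hN⟩ := eventually_atTop.mp (hgeom.eventually_lt_const (half_pos hε))
  refine ⟨N, fun m hm => ?_⟩
  have hm1 := hN m hm.le
  have hMm := hMpos m
  have hr1 : M (m + 1) / M m ≤ 1 := div_le_one_of_le₀ (hle m) hMm.le
  have hr2 : 1 - M (m + 1) / M m ≤ δ + ((1 - δ) / c) ^ m * (M 0 / κ) := by
    have hcm : 0 < c ^ m * κ := by positivity
    have h1 : 1 - M (m + 1) / M m = (M m - M (m + 1)) / M m := by field_simp
    rw [h1, div_le_iff₀ hMm, add_mul]
    refine (hupper m).trans (add_le_add_right ?_ _)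
    have h2 : ((1 - δ) / c) ^ m * (M 0 / κ) * M m
        = ((1 - δ) ^ m * M 0) * (M m / (c ^ m * κ)) := by
      rw [div_pow]
      field_simp
    rw [h2]
    exact le_mul_of_one_le_right
      (mul_nonneg (pow_nonneg (by linarith) m) (hMpos 0).le) ((one_le_div hcm).mpr (hlower m))
  rw [Real.dist_eq, abs_sub_comm, abs_of_nonneg (by linarith)]
  linarith

/-! ### Consequences for the sequence -/

theorem intervalIntegrable_carlemanG_mul_pow (m : ℕ) :
    IntervalIntegrable (fun s => carlemanG s * s ^ m) MeasureTheory.volume 0 1 := by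
  refine ContinuousOn.intervalIntegrable ?_
  rw [Set.uIcc_of_le zero_le_one]
  exact continuousOn_carlemanG.mul (continuousOn_pow m)

theorem carlemanB_add_two (m : ℕ) :
    carlemanB (m + 2) = 1 / Real.exp 1 * ∫ s in (0 : ℝ)..1, carlemanG s * s ^ m := by
  rw [← exp_one_mul_carlemanB_eq_integral]
  field_simp

theorem carlemanB_pos {n : ℕ} (hn : 1 ≤ n) : 0 < carlemanB n := by
  rcases hn.eq_or_lt with rfl | h
  · rw [carlemanB_one]; norm_num
  · obtain ⟨m, rfl⟩ := Nat.exists_eq_add_of_le' h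
    rw [carlemanB_add_two]
    refine mul_pos (by positivity) ?_
    exact intervalIntegral.intervalIntegral_pos_of_pos_on (intervalIntegrable_carlemanG_mul_pow m)
      (fun s hs => mul_pos (carlemanG_pos hs) (pow_pos hs.1 m)) zero_lt_one

/-- By positivity the sum subtracted in the recurrence can be dropped. -/
theorem carlemanB_le {n : ℕ} (hn : 1 ≤ n) : carlemanB n ≤ 1 / ((n : ℝ) * ((n : ℝ) + 1)) := by
  rcases hn.eq_or_lt with rfl | h
  · rw [carlemanB_one]; norm_num
  · have hsum : 0 ≤ ∑ k ∈ Finset.range (n - 1), carlemanB (n - k - 1) / ((k : ℝ) + 2) := by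
      refine Finset.sum_nonneg fun k hk => ?_
      rw [Finset.mem_range] at hk
      have := carlemanB_pos (n := n - k - 1) (by omega)
      positivity
    rw [carlemanB_rec n h, ← one_div_mul_one_div]
    exact mul_le_mul_of_nonneg_left (by linarith) (by positivity)

theorem carlemanB_succ_lt {n : ℕ} (hn : 1 ≤ n) : carlemanB (n + 1) < carlemanB n := by
  rcases hn.eq_or_lt with rfl | h
  -- The integral formula starts at index two, so here `b₂ ≤ 1/6 < b₁` is used.
  · refine (carlemanB_le (by norm_num)).trans_lt ?_
    rw [carlemanB_one]
    norm_num
  · obtain ⟨m, rfl⟩ := Nat.exists_eq_add_of_le' h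
    rw [show m + 1 + 1 + 1 = (m + 1) + 2 by rfl, carlemanB_add_two, carlemanB_add_two]
    refine mul_lt_mul_of_pos_left ?_ (by positivity)
    rw [← sub_pos, ← intervalIntegral.integral_sub (intervalIntegrable_carlemanG_mul_pow m)
      (intervalIntegrable_carlemanG_mul_pow (m + 1))]
    refine intervalIntegral.intervalIntegral_pos_of_pos_on
      ((intervalIntegrable_carlemanG_mul_pow m).sub (intervalIntegrable_carlemanG_mul_pow (m + 1)))
      (fun s hs => ?_) zero_lt_one
    rw [sub_pos]
    exact mul_lt_mul_of_pos_left (pow_lt_pow_right_of_lt_one₀ hs.1 hs.2 m.lt_succ_self)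
      (carlemanG_pos hs)

theorem tendsto_carlemanB_ratio :
    Tendsto (fun n : ℕ => carlemanB (n + 1) / carlemanB n) atTop (𝓝 1) := by
  rw [← tendsto_add_atTop_iff_nat 2]
  refine (tendsto_moment_ratio continuousOn_carlemanG fun s hs => carlemanG_pos hs).congr fun m => ?_
  rw [show m + 2 + 1 = (m + 1) + 2 by ring, carlemanB_add_two, carlemanB_add_two,
    mul_div_mul_left _ _ (by positivity)]

theorem theorem1 :
    (∀ n : ℕ, 2 ≤ n →
      IntervalIntegrable (fun s : ℝ => carlemanG s * (1 - s) ^ (n - 2))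
        MeasureTheory.volume 0 1 ∧
      IntervalIntegrable (fun s : ℝ => carlemanG s * s ^ (n - 2))
        MeasureTheory.volume 0 1 ∧
      carlemanB n =
        1 / Real.exp 1 * ∫ s in (0 : ℝ)..1, carlemanG s * (1 - s) ^ (n - 2) ∧
      carlemanB n =
        1 / Real.exp 1 * ∫ s in (0 : ℝ)..1, carlemanG s * s ^ (n - 2)) ∧
    (∀ n : ℕ, 1 ≤ n →
      0 < carlemanB n ∧ carlemanB n ≤ 1 / ((n : ℝ) * ((n : ℝ) + 1))) ∧
    (∀ n : ℕ, 1 ≤ n → carlemanB (n + 1) < carlemanB n) ∧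
    Filter.Tendsto (fun n : ℕ => carlemanB (n + 1) / carlemanB n)
      Filter.atTop (nhds 1) := by
  refine ⟨fun n hn => ?_, fun n hn => ⟨carlemanB_pos hn, carlemanB_le hn⟩,
    fun n hn => carlemanB_succ_lt hn, tendsto_carlemanB_ratio⟩
  obtain ⟨m, rfl⟩ := Nat.exists_eq_add_of_le' hn
  rw [Nat.add_sub_cancel]
  -- The substitution `s ↦ 1 - s` fixes `g` and exchanges the two integrals.
  have hrefl := intervalIntegral.integral_comp_sub_left (a := 0) (b := 1)
    (fun s => carlemanG s * s ^ m) 1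
  simp only [carlemanG_one_sub, sub_self, sub_zero] at hrefl
  have hint : IntervalIntegrable (fun s => carlemanG s * (1 - s) ^ m) MeasureTheory.volume 0 1 := by
    refine ContinuousOn.intervalIntegrable ?_
    rw [Set.uIcc_of_le zero_le_one]
    exact continuousOn_carlemanG.mul (by fun_prop)
  refine ⟨hint, intervalIntegrable_carlemanG_mul_pow m, ?_, carlemanB_add_two m⟩
  rw [hrefl, carlemanB_add_two]
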